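/- **Lemma (level functions).** Let $\mathcal G$ be the class of functions $G:\mathbb R_+\to\mathbb R_+$ of the form $$G(z)=c\,\mathbf 1_{z>0}+\gamma_0 z+\int_{(0,\infty)}(1-e^{-rz})\,\nu(dr),$$ where $c,\gamma_0\ge 0$ and $\nu$ is a (non-negative) measure on $(0,\infty)$ with $\int_{(0,\infty)}\min(r,1)\,\nu(dr)<\infty$. A *subordinator* is a process $X=(X_t)_{t\ge0}$ with values in $[0,\infty]$ such that $X_0=0$ a.s.; $\lim_{t\searrow0}\mathbb P(X_t>\varepsilon)=0$ for every $\varepsilon>0$; $X_t\le X_{t+s}$ a.s. for all $s,t\ge 0$ (so $\infty$ is absorbing); and the increments are stationary and independent as long as the process is finite: for all $t,s\ge0$, conditionally on $\{X_t<\infty\}$, $X_{t+s}-X_t$ has the law of $X_s$, and for all $0\le t_0\le t_1\le\dots\le t_{n+1}$, conditionally on $\{X_{t_n}<\infty\}$, the increments $X_{t_1}-X_{t_0},\dots,X_{t_{n+1}}-X_{t_n}$ are mutually independent. It has *Laplace exponent* $G$ if $\mathbb E\,e^{-zX_t}=e^{-tG(z)}$ for all $t,z\ge0$ (with $e^{-\infty}=0$,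 $0\cdot\infty=0$). For $r>0$, $\mathrm{Exp}(r)$ is the exponential law with rate $r$; $\mathrm{Exp}(0)$ is the point mass at $\infty$. By convention $\inf\emptyset=\infty$. For every $G\in\mathcal G$ there is a subordinator with Laplace exponent $G$, and there is a deterministic function $\ell_G:\mathbb R_+\times[0,1]\to[0,\infty]$ such that for every subordinator $X$ with Laplace exponent $G$, $$\ell_G(a,b)=\inf\{t\ge 0 : \mathbb P(X_t\ge a)\ge b\}\qquad (a\ge0,\ 0\le b\le1).$$ If $G\not\equiv0$, then $\ell_G$ is finite on $(0,\infty)\times(0,1)$. Moreover: 1. (2D-monotonicity) for all $a,a'\in\mathbb R_+$ and $b,b'\in[0,1]$, $a\le a'$ and $b\le b'$ imply $\ell_G(a,b)\le\ell_G(a',b')$; 2. ($G$-transformation) for every $\lambda>0$, if $Y\sim\mathrm{Exp}(\lambda)$ and $U\sim\mathrm{Uniform}(0,1)$ are independent, then $\ell_G(Y,U)\sim\mathrm{Exp}(G(\lambda))$. -/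

import Mathlib

open MeasureTheory ProbabilityTheory Filter Topology
open scoped NNReal ENNReal

/-- `G : ℝ₊ → ℝ₊` has killing rate `c`, drift `γ₀` and Lévy measure `ν`:
`G z = c 𝟙_{z > 0} + γ₀ z + ∫_{(0,∞)} (1 - e^{-rz}) ν(dr)`, where `∫_{(0,∞)} min(r,1) ν(dr) < ∞`.
Only the restriction of `ν` to `(0,∞)` matters. -/
structure HasLevyTriple (G : ℝ≥0 → ℝ≥0) (c γ₀ : ℝ≥0) (ν : Measure ℝ) : Prop where
  lintegral_min_lt_top : ∫⁻ r in Set.Ioi 0, ENNReal.ofReal (min r 1) ∂ν < ∞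
  eq : ∀ z : ℝ≥0, (G z : ℝ) =
    c * (if 0 < z then 1 else 0) + γ₀ * z + ∫ r in Set.Ioi (0 : ℝ), (1 - Real.exp (-(r * z))) ∂ν

/-- The class `𝒢` of functions with a Lévy–Khintchine representation. -/
def LevyClass : Set (ℝ≥0 → ℝ≥0) :=
  {G | ∃ (c γ₀ : ℝ≥0) (ν : Measure ℝ), HasLevyTriple G c γ₀ ν}

/-- Non-negative Lévy processes (subordinators), with `∞` allowed as a value (killing).
An increment `X (t + s) - X t` is meaningful only on the event `X t < ∞`, so stationarity and
independence of the increments are imposed conditionally on the finiteness of the left endpoint of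
the last increment; if `X` is almost surely finite, the conditioning is void. Non-negativity of the
increments is a field of its own because subtraction in `ℝ≥0∞` is truncated; this field also says
that `∞` is absorbing. -/
structure IsSubordinator {Ω : Type*} [MeasurableSpace Ω] (X : ℝ≥0 → Ω → ℝ≥0∞) (P : Measure Ω) :
    Prop where
  measurable : ∀ t, Measurable (X t)
  increment_nonneg : ∀ t s, X t ≤ᵐ[P] X (t + s)
  stationary_increments : ∀ t s,
    (P[|{ω | X t ω < ∞}]).map (fun ω => X (t + s) ω - X t ω) = P.map (X s)
  independent_increments : ∀ t : ℕ → ℝ≥0, Monotone t → ∀ n : ℕ,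
    iIndepFun (fun (i : Fin (n + 1)) ω => X (t (i + 1)) ω - X (t i) ω) (P[|{ω | X (t n) ω < ∞}])
  start_zero : X 0 =ᵐ[P] 0
  stochastic_continuity : ∀ ε : ℝ≥0∞, 0 < ε →
    Tendsto (fun t : ℝ≥0 => P {ω | ε < X t ω}) (𝓝[>] 0) (𝓝 0)

/-- `𝔼 e^{-z X_t} = e^{-t G(z)}` for all `t, z ≥ 0`, with `e^{-∞} = 0` and `0 · ∞ = 0`. -/
def HasLaplaceExponent {Ω : Type*} [MeasurableSpace Ω] (X : ℝ≥0 → Ω → ℝ≥0∞) (P : Measure Ω)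
    (G : ℝ≥0 → ℝ≥0) : Prop :=
  ∀ t z : ℝ≥0, ∫⁻ ω, EReal.exp (-(((z : ℝ≥0∞) * X t ω : ℝ≥0∞) : EReal)) ∂P =
    ENNReal.ofReal (Real.exp (-(t * G z)))

/-- `inf {t ≥ 0 | P(X_t ≥ a) ≥ b}` for `a, b ≥ 0`, with `inf ∅ = ∞`. -/
noncomputable def inducedLevel {Ω : Type*} [MeasurableSpace Ω] (X : ℝ≥0 → Ω → ℝ≥0∞)
    (P : Measure Ω) (a b : ℝ) : ℝ≥0∞ :=
  ⨅ (t : ℝ≥0) (_ : ENNReal.ofReal b ≤ P {ω | ENNReal.ofReal a ≤ X t ω}), (t : ℝ≥0∞)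

/-- The exponential law with rate `r ≥ 0` as a law on `[0,∞]`; rate `0` gives the point mass
at `∞`. -/
noncomputable def extExpLaw (r : ℝ≥0) : Measure ℝ≥0∞ :=
  if r = 0 then Measure.dirac ∞ else (expMeasure r).map ENNReal.ofReal

/-! Existence: take a Poisson point process of jumps on time × size with intensity Lebesgue ⊗ `ρ`,
where `ρ` is the Lévy measure plus an atom of mass `c` at `∞`, so that killing is just a jump of
infinite size. Drift plus the sum of the jumps up to time `t` has the required exponent by the
Laplace functional (`lintegral_expNeg_pointSum`), and jumps in disjoint time windows are independent
(`iIndepFun_pointSum`).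

Level function: `inducedLevel` only involves the one-dimensional laws of `X`, which `G` determines
because a finite measure on `[0,∞]` is determined by its Laplace transform (Stone–Weierstrass).
Hence the level function of the constructed process serves for every `X`. It is finite because
`P(X_t < a) ≤ e^{za - tG(z)}`, which tends to 0 when `G z > 0`.

`G`-transformation: integrating out `U`, then exchanging `Y` and `X_t` by Fubini, `P(U ≤ P(X_t ≥ Y))
= P(Y ≤ X_t) = E(1 - e^{-λX_t}) = 1 - e^{-tG(λ)}`. Since `P(X_t ≥ a)` is nondecreasing in `t`, the
event `ℓ(Y,U) < t` is the increasing union of these events along times `u n ↑ t` with `u n < t`, so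
its probability is again `1 - e^{-tG(λ)}`. -/

/-! ### Laplace transforms on `[0,∞]^ι`. -/

/-- The function `x ↦ e^{-x}` on `[0,∞]`, with `e^{-∞} = 0`. -/
noncomputable def expNeg (x : ℝ≥0∞) : ℝ≥0∞ := EReal.exp (-(x : EReal))

@[simp] lemma expNeg_zero : expNeg 0 = 1 := by simp [expNeg]

@[simp] lemma expNeg_top : expNeg ∞ = 0 := by simp [expNeg]

lemma expNeg_ofReal {r : ℝ} (hr : 0 ≤ r) :
    expNeg (ENNReal.ofReal r) = ENNReal.ofReal (Real.exp (-r)) := by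
  rw [expNeg, EReal.coe_ennreal_ofReal, max_eq_left hr, ← EReal.coe_neg, EReal.exp_coe]

lemma expNeg_coe (r : ℝ≥0) : expNeg r = ENNReal.ofReal (Real.exp (-r)) := by
  rw [← expNeg_ofReal r.coe_nonneg, ENNReal.ofReal_coe_nnreal]

lemma expNeg_strictAnti : StrictAnti expNeg := fun x y h ↦ by
  rw [expNeg, expNeg, EReal.exp_lt_exp_iff, EReal.neg_lt_neg_iff]
  exact_mod_cast h

lemma expNeg_le_one (x : ℝ≥0∞) : expNeg x ≤ 1 := by
  simpa using expNeg_strictAnti.antitone (zero_le (a := x))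

lemma expNeg_ne_top (x : ℝ≥0∞) : expNeg x ≠ ∞ :=
  ((expNeg_le_one x).trans_lt ENNReal.one_lt_top).ne

lemma expNeg_add (x y : ℝ≥0∞) : expNeg (x + y) = expNeg x * expNeg y := by
  rw [expNeg, EReal.coe_ennreal_add, EReal.neg_add, sub_eq_add_neg, EReal.exp_add, expNeg, expNeg]
  · left; simp
  · right; simp

lemma expNeg_sum {ι : Type*} (s : Finset ι) (f : ι → ℝ≥0∞) :
    expNeg (∑ i ∈ s, f i) = ∏ i ∈ s, expNeg (f i) := by
  classical
  induction s using Finset.induction_on with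
  | empty => simp
  | insert a s ha ih => rw [Finset.sum_insert ha, Finset.prod_insert ha, expNeg_add, ih]

lemma continuous_expNeg : Continuous expNeg :=
  ENNReal.continuous_exp.comp (continuous_neg.comp continuous_coe_ennreal_ereal)

@[fun_prop] lemma measurable_expNeg : Measurable expNeg := continuous_expNeg.measurable

lemma tendsto_prod_expNeg (f : ℕ → ℝ≥0∞) :
    Tendsto (fun n ↦ ∏ k ∈ Finset.range n, expNeg (f k)) atTop (𝓝 (expNeg (∑' k, f k))) := by
  simp_rw [← expNeg_sum]
  exact (continuous_expNeg.tendsto _).comp (ENNReal.tendsto_nat_tsum f)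

/-- The bounded continuous function `x ↦ e^{-⟨z, x⟩}` on `[0,∞]^ι`. -/
noncomputable def laplaceKernel {ι : Type*} [Fintype ι] (z : ι → ℝ≥0) :
    BoundedContinuousFunction (ι → ℝ≥0∞) ℝ :=
  BoundedContinuousFunction.mkOfCompact
    ⟨fun x ↦ (expNeg (∑ i, (z i : ℝ≥0∞) * x i)).toReal, by
      refine ENNReal.continuousOn_toReal.comp_continuous (continuous_expNeg.comp ?_)
        fun x ↦ expNeg_ne_top _
      exact continuous_finsetSum _ fun i _ ↦
        (ENNReal.continuous_const_mul ENNReal.coe_ne_top).comp (continuous_apply i)⟩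

lemma laplaceKernel_apply {ι : Type*} [Fintype ι] (z : ι → ℝ≥0) (x : ι → ℝ≥0∞) :
    laplaceKernel z x = (expNeg (∑ i, (z i : ℝ≥0∞) * x i)).toReal := rfl

lemma laplaceKernel_zero {ι : Type*} [Fintype ι] :
    laplaceKernel (0 : ι → ℝ≥0) = 1 := by
  ext x; simp [laplaceKernel_apply]

lemma laplaceKernel_add {ι : Type*} [Fintype ι] (z w : ι → ℝ≥0) :
    laplaceKernel (z + w) = laplaceKernel z * laplaceKernel w := by
  ext x
  simp [laplaceKernel_apply, add_mul, Finset.sum_add_distrib, expNeg_add]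

/-- A finite measure on `[0,∞]^ι` is determined by its multivariate Laplace transform. -/
theorem MeasureTheory.Measure.ext_of_laplace {ι : Type*} [Fintype ι] {μ ν : Measure (ι → ℝ≥0∞)}
    [IsFiniteMeasure μ] [IsFiniteMeasure ν]
    (h : ∀ z : ι → ℝ≥0, ∫⁻ x, expNeg (∑ i, (z i : ℝ≥0∞) * x i) ∂μ =
      ∫⁻ x, expNeg (∑ i, (z i : ℝ≥0∞) * x i) ∂ν) : μ = ν := by
  classical
  -- Kernels multiply by adding their parameters, so their linear span is already an algebra;
  -- `[0,∞]^ι` is compact, so the kernels are bounded and continuous.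
  let V : Submodule ℝ (BoundedContinuousFunction (ι → ℝ≥0∞) ℝ) :=
    Submodule.span ℝ (Set.range laplaceKernel)
  have hone : (1 : BoundedContinuousFunction (ι → ℝ≥0∞) ℝ) ∈ V :=
    Submodule.subset_span ⟨0, laplaceKernel_zero⟩
  have hmul : ∀ f g, f ∈ V → g ∈ V → f * g ∈ V := by
    intro f g hf hg
    induction hf using Submodule.span_induction with
    | mem f hf =>
      obtain ⟨z, rfl⟩ := hf
      induction hg using Submodule.span_induction with
      | mem g hg =>
        obtain ⟨w, rfl⟩ := hg
        exact Submodule.subset_span ⟨z + w, laplaceKernel_add z w⟩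
      | zero => simp
      | add g g' _ _ h h' => rw [mul_add]; exact V.add_mem h h'
      | smul a g _ h => rw [mul_smul_comm]; exact V.smul_mem a h
    | zero => simp
    | add f f' _ _ h h' => rw [add_mul]; exact V.add_mem h h'
    | smul a f _ h => rw [smul_mul_assoc]; exact V.smul_mem a h
  let A : StarSubalgebra ℝ (BoundedContinuousFunction (ι → ℝ≥0∞) ℝ) :=
    { V.toSubalgebra hone hmul with
      star_mem' := fun {f} hf ↦ by
        have : star f = f := by ext x; simp
        rwa [this] }
  refine ext_of_forall_mem_subalgebra_integral_eq_of_polish (𝕜 := ℝ) (A := A) ?_ ?_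
  · intro x y hxy
    obtain ⟨i, hi⟩ := Function.ne_iff.1 hxy
    -- This kernel is `x ↦ e^{-x i}`, which is injective in `x i` on all of `[0,∞]`.
    refine ⟨_, ⟨_, ⟨laplaceKernel (Pi.single i 1), Submodule.subset_span ⟨_, rfl⟩, rfl⟩, rfl⟩, ?_⟩
    have key : ∀ x : ι → ℝ≥0∞, ∑ j, ((Pi.single i 1 : ι → ℝ≥0) j : ℝ≥0∞) * x j = x i := by
      intro x
      rw [Finset.sum_eq_single i] <;> simp +contextual
    change laplaceKernel _ x ≠ laplaceKernel _ y
    rw [laplaceKernel_apply, laplaceKernel_apply, key, key, Ne,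
      ENNReal.toReal_eq_toReal_iff' (expNeg_ne_top _) (expNeg_ne_top _)]
    exact fun h ↦ hi (expNeg_strictAnti.injective h)
  · intro g (hg : g ∈ V)
    induction hg using Submodule.span_induction with
    | mem g hg =>
      obtain ⟨z, rfl⟩ := hg
      simp_rw [laplaceKernel_apply]
      rw [integral_toReal, integral_toReal, h z]
      · exact Measurable.aemeasurable (by fun_prop)
      · exact ae_of_all _ fun _ ↦ (expNeg_ne_top _).lt_top
      · exact Measurable.aemeasurable (by fun_prop)
      · exact ae_of_all _ fun _ ↦ (expNeg_ne_top _).lt_top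
    | zero => simp
    | add g g' _ _ h h' =>
      simp only [BoundedContinuousFunction.coe_add, Pi.add_apply]
      rw [integral_add (g.integrable _) (g'.integrable _),
        integral_add (g.integrable _) (g'.integrable _), h, h']
    | smul a g _ h =>
      simp only [BoundedContinuousFunction.coe_smul]
      rw [integral_smul, integral_smul, h]

/-- A finite measure on `[0,∞]` is determined by its Laplace transform. -/
theorem MeasureTheory.Measure.ext_of_laplace_one {μ ν : Measure ℝ≥0∞}
    [IsFiniteMeasure μ] [IsFiniteMeasure ν]
    (h : ∀ z : ℝ≥0, ∫⁻ x, expNeg (z * x) ∂μ = ∫⁻ x, expNeg (z * x) ∂ν) : μ = ν := by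
  have hm : Measurable fun (x : ℝ≥0∞) (_ : Unit) ↦ x := by fun_prop
  have key : μ.map (fun x (_ : Unit) ↦ x) = ν.map (fun x (_ : Unit) ↦ x) := by
    refine Measure.ext_of_laplace fun z ↦ ?_
    rw [lintegral_map (by fun_prop) hm, lintegral_map (by fun_prop) hm]
    simpa using h (z ())
  have hback (ρ : Measure ℝ≥0∞) :
      (ρ.map (fun x (_ : Unit) ↦ x)).map (fun f ↦ f ()) = ρ := by
    rw [Measure.map_map (by fun_prop) hm]
    exact Measure.map_id
  rw [← hback μ, key, hback]

/-! ### Poisson point processes and their Laplace functional. -/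

lemma lintegral_pi_prod_const {E : Type*} [MeasurableSpace E] (μ : Measure E) [IsFiniteMeasure μ]
    {f : E → ℝ≥0∞} (hf : Measurable f) (n : ℕ) :
    ∫⁻ x : Fin n → E, ∏ i, f (x i) ∂(Measure.pi fun _ ↦ μ) = (∫⁻ x, f x ∂μ) ^ n := by
  induction n with
  | zero => simp
  | succ n ih =>
    have h := (measurePreserving_piFinSuccAbove (fun _ : Fin (n + 1) ↦ μ) 0)
    have hg : Measurable fun p : E × (Fin n → E) ↦ f p.1 * ∏ i, f (p.2 i) := by fun_prop
    have := h.lintegral_comp hg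
    simp only [Fin.prod_univ_succ]
    rw [pow_succ', ← ih, ← lintegral_prod_mul hf.aemeasurable (Measurable.aemeasurable (by fun_prop)), ← this]
    rfl

/-- The law of a Poisson point configuration with finite intensity measure `μ`. -/
noncomputable def poissonConfig {E : Type*} [MeasurableSpace E] (μ : Measure E) :
    Measure (Σ n : ℕ, Fin n → E) :=
  Measure.sum fun n ↦ ENNReal.ofReal (Real.exp (-μ.real Set.univ) / n.factorial) •
    (Measure.pi fun _ : Fin n ↦ μ).map (Sigma.mk n)

/-- The sum of `f` over the points of a finite configuration. -/
noncomputable def configSum {E : Type*} (f : E → ℝ≥0∞) (ω : Σ n : ℕ, Fin n → E) : ℝ≥0∞ :=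
  ∑ i, f (ω.2 i)

lemma measurable_sigma_mk {ι : Type*} {α : ι → Type*} [∀ i, MeasurableSpace (α i)] (i : ι) :
    Measurable (Sigma.mk i : α i → Sigma α) := fun _ hs ↦ by
  exact (MeasurableSpace.measurableSet_iInf.1 hs) i

lemma measurable_of_sigma {ι β : Type*} {α : ι → Type*} [∀ i, MeasurableSpace (α i)]
    [MeasurableSpace β] {f : Sigma α → β} (h : ∀ i, Measurable fun x ↦ f ⟨i, x⟩) :
    Measurable f := fun _ hs ↦ MeasurableSpace.measurableSet_iInf.2 fun i ↦ h i hs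

@[fun_prop] lemma measurable_configSum {E : Type*} [MeasurableSpace E] {f : E → ℝ≥0∞} (hf : Measurable f) :
    Measurable (configSum f) :=
  measurable_of_sigma fun n ↦ by 
    exact Finset.measurable_sum Finset.univ fun (i : Fin n) _ ↦ hf.comp (measurable_pi_apply i)

/-- With `a = ∫ e^{-f} dμ`, configurations of `n` points contribute `e^{-|μ|} a^n / n!`; the
exponential series sums to `e^{a - |μ|}`. -/
lemma lintegral_expNeg_configSum {E : Type*} [MeasurableSpace E] (μ : Measure E)
    [IsFiniteMeasure μ] {f : E → ℝ≥0∞} (hf : Measurable f) :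
    ∫⁻ ω, expNeg (configSum f ω) ∂poissonConfig μ = expNeg (∫⁻ x, (1 - expNeg (f x)) ∂μ) := by
  have hle : ∫⁻ x, expNeg (f x) ∂μ ≤ μ Set.univ := by
    simpa using lintegral_mono (μ := μ) (fun x ↦ expNeg_le_one (f x))
  have hfin : ∫⁻ x, expNeg (f x) ∂μ ≠ ∞ := (hle.trans_lt (measure_lt_top μ _)).ne
  set a := (∫⁻ x, expNeg (f x) ∂μ).toReal with ha
  have ha' : ∫⁻ x, expNeg (f x) ∂μ = ENNReal.ofReal a := (ENNReal.ofReal_toReal hfin).symm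
  have ha0 : 0 ≤ a := ENNReal.toReal_nonneg
  have ham : a ≤ μ.real Set.univ := ENNReal.toReal_mono (measure_ne_top μ _) hle
  have hright : ∫⁻ x, (1 - expNeg (f x)) ∂μ = ENNReal.ofReal (μ.real Set.univ - a) := by
    rw [lintegral_sub (by fun_prop) hfin (ae_of_all _ fun x ↦ expNeg_le_one _), ha',
      ENNReal.ofReal_sub _ ha0, ofReal_measureReal]
    simp
  rw [hright, expNeg_ofReal (sub_nonneg.2 ham), poissonConfig, lintegral_sum_measure]
  have hterm (n : ℕ) : ∫⁻ ω, expNeg (configSum f ω)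
      ∂(ENNReal.ofReal (Real.exp (-μ.real Set.univ) / n.factorial) •
        (Measure.pi fun _ : Fin n ↦ μ).map (Sigma.mk n)) =
      ENNReal.ofReal (Real.exp (-μ.real Set.univ) * (a ^ n / n.factorial)) := by
    rw [lintegral_smul_measure, lintegral_map (f := fun ω ↦ expNeg (configSum f ω)) (by fun_prop)
      (measurable_sigma_mk n)]
    simp only [configSum, expNeg_sum]
    rw [lintegral_pi_prod_const μ (f := fun x ↦ expNeg (f x)) (by fun_prop), ha', ← ENNReal.ofReal_pow ha0,
      smul_eq_mul, ← ENNReal.ofReal_mul (by positivity)]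
    congr 1; ring
  have hs : HasSum (fun n : ℕ ↦ a ^ n / n.factorial) (Real.exp a) := by
    rw [Real.exp_eq_exp_ℝ]; exact NormedSpace.expSeries_div_hasSum_exp a
  simp_rw [hterm]
  rw [← ENNReal.ofReal_tsum_of_nonneg (fun n ↦ by positivity) (hs.summable.mul_left _),
    tsum_mul_left, hs.tsum_eq, ← Real.exp_add]
  congr 2; ring

instance {E : Type*} [MeasurableSpace E] (μ : Measure E) [IsFiniteMeasure μ] :
    IsProbabilityMeasure (poissonConfig μ) where
  measure_univ := by
    simpa [configSum] using lintegral_expNeg_configSum μ (f := fun _ ↦ 0) measurable_const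

/-- The law of a Poisson point process with s-finite intensity measure `μ`, as a superposition of
independent finite configurations. -/
noncomputable def poissonProcessLaw {E : Type*} [MeasurableSpace E] (μ : Measure E) [SFinite μ] :
    Measure (ℕ → Σ n : ℕ, Fin n → E) :=
  Measure.infinitePi fun k ↦ poissonConfig (sfiniteSeq μ k)

instance {E : Type*} [MeasurableSpace E] (μ : Measure E) [SFinite μ] :
    IsProbabilityMeasure (poissonProcessLaw μ) := by
  unfold poissonProcessLaw; infer_instance

/-- The sum of `f` over the points of a countable superposition of finite configurations. -/
noncomputable def pointSum {E : Type*} (f : E → ℝ≥0∞) (ω : ℕ → Σ n : ℕ, Fin n → E) : ℝ≥0∞ :=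
  ∑' k, configSum f (ω k)

@[fun_prop] lemma measurable_pointSum {E : Type*} [MeasurableSpace E] {f : E → ℝ≥0∞}
    (hf : Measurable f) : Measurable (pointSum f) :=
  Measurable.tsum fun k ↦ (measurable_configSum hf).comp (measurable_pi_apply k)

lemma pointSum_zero {E : Type*} (ω : ℕ → Σ n : ℕ, Fin n → E) :
    pointSum (fun _ ↦ 0) ω = 0 := by simp [pointSum, configSum]

lemma pointSum_add {E : Type*} (f g : E → ℝ≥0∞) (ω : ℕ → Σ n : ℕ, Fin n → E) :
    pointSum (fun x ↦ f x + g x) ω = pointSum f ω + pointSum g ω := by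
  simp [pointSum, configSum, Finset.sum_add_distrib, ENNReal.tsum_add]

lemma pointSum_const_mul {E : Type*} (a : ℝ≥0∞) (f : E → ℝ≥0∞) (ω : ℕ → Σ n : ℕ, Fin n → E) :
    pointSum (fun x ↦ a * f x) ω = a * pointSum f ω := by
  simp [pointSum, configSum, ← Finset.mul_sum, ENNReal.tsum_mul_left]

lemma pointSum_finset_sum {E ι : Type*} (s : Finset ι) (f : ι → E → ℝ≥0∞)
    (ω : ℕ → Σ n : ℕ, Fin n → E) :
    pointSum (fun x ↦ ∑ i ∈ s, f i x) ω = ∑ i ∈ s, pointSum (f i) ω := by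
  classical
  induction s using Finset.induction_on with
  | empty => simp [pointSum_zero]
  | insert a s ha ih => simp [Finset.sum_insert ha, pointSum_add, ih]

/-- The Laplace functional of a Poisson point process. -/
theorem lintegral_expNeg_pointSum {E : Type*} [MeasurableSpace E] (μ : Measure E) [SFinite μ]
    {f : E → ℝ≥0∞} (hf : Measurable f) :
    ∫⁻ ω, expNeg (pointSum f ω) ∂poissonProcessLaw μ = expNeg (∫⁻ x, (1 - expNeg (f x)) ∂μ) := by
  have hc := measurable_configSum hf
  have hind : iIndepFun (fun (k : ℕ) (ω : ℕ → Σ n : ℕ, Fin n → E) ↦ expNeg (configSum f (ω k)))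
      (poissonProcessLaw μ) :=
    iIndepFun_infinitePi (fun _ ↦ measurable_expNeg.comp hc)
  have hmarg (k : ℕ) : ∫⁻ ω, expNeg (configSum f (ω k)) ∂poissonProcessLaw μ =
      expNeg (∫⁻ x, (1 - expNeg (f x)) ∂sfiniteSeq μ k) := by
    rw [← lintegral_expNeg_configSum _ hf,
      ← Measure.infinitePi_map_eval (fun k ↦ poissonConfig (sfiniteSeq μ k)) k,
      lintegral_map (f := fun ω ↦ expNeg (configSum f ω)) (by fun_prop) (measurable_pi_apply k)]
    rfl
  have hprod (n : ℕ) :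
      ∫⁻ ω, ∏ k ∈ Finset.range n, expNeg (configSum f (ω k)) ∂poissonProcessLaw μ =
        ∏ k ∈ Finset.range n, expNeg (∫⁻ x, (1 - expNeg (f x)) ∂sfiniteSeq μ k) := by
    rw [lintegral_prod_eq_prod_lintegral_of_indepFun _ _ hind (fun k ↦
      (measurable_expNeg.comp hc).comp (measurable_pi_apply k))]
    simp_rw [hmarg]
  have h1 : Tendsto (fun n ↦
      ∫⁻ ω, ∏ k ∈ Finset.range n, expNeg (configSum f (ω k)) ∂poissonProcessLaw μ) atTop
      (𝓝 (∫⁻ ω, expNeg (pointSum f ω) ∂poissonProcessLaw μ)) := by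
    refine tendsto_lintegral_of_dominated_convergence (fun _ ↦ 1) (fun n ↦ ?_) (fun n ↦ ?_)
      (by simp) ?_
    · exact Finset.measurable_prod _ fun k _ ↦
        (measurable_expNeg.comp hc).comp (measurable_pi_apply k)
    · exact ae_of_all _ fun ω ↦ Finset.prod_le_one' fun k _ ↦ expNeg_le_one _
    · exact ae_of_all _ fun ω ↦ tendsto_prod_expNeg _
  simp_rw [hprod] at h1
  refine tendsto_nhds_unique h1 ?_
  -- The product over the finite pieces turns into a sum in the exponent, and the pieces add up to
  -- `μ`.
  have h2 := tendsto_prod_expNeg fun k ↦ ∫⁻ x, (1 - expNeg (f x)) ∂sfiniteSeq μ k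
  rwa [← lintegral_sum_measure, sum_sfiniteSeq] at h2

/-- Sums over a Poisson point process of functions with disjoint supports are independent. -/
theorem iIndepFun_pointSum {E ι : Type*} [MeasurableSpace E] [Fintype ι] (μ : Measure E)
    [SFinite μ] {f : ι → E → ℝ≥0∞} (hf : ∀ i, Measurable (f i))
    (hdisj : ∀ x i j, i ≠ j → f i x = 0 ∨ f j x = 0) :
    iIndepFun (fun i ↦ pointSum (f i)) (poissonProcessLaw μ) := by
  have hm (i : ι) : Measurable (pointSum (f i)) := measurable_pointSum (hf i)
  rw [iIndepFun_iff_map_fun_eq_pi_map fun i ↦ (hm i).aemeasurable]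
  have (i : ι) : IsProbabilityMeasure ((poissonProcessLaw μ).map (pointSum (f i))) :=
    Measure.isProbabilityMeasure_map (hm i).aemeasurable
  refine Measure.ext_of_laplace fun z ↦ ?_
  -- At most one summand is nonzero at each point, so `1 - e^{-·}` is additive here; this is what
  -- makes the joint Laplace transform factor.
  have hpt (x : E) : 1 - expNeg (∑ i, (z i : ℝ≥0∞) * f i x) =
      ∑ i, (1 - expNeg ((z i : ℝ≥0∞) * f i x)) := by
    by_cases h : ∃ i, f i x ≠ 0
    · obtain ⟨i, hi⟩ := h
      have h0 (j : ι) (hj : j ≠ i) : f j x = 0 := (hdisj x j i hj).resolve_right hi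
      rw [Finset.sum_eq_single i (fun j _ hj ↦ by simp [h0 j hj]) (by simp),
        Finset.sum_eq_single i (fun j _ hj ↦ by simp [h0 j hj]) (by simp)]
    · push Not at h
      simp [h]
  rw [lintegral_map (by fun_prop) (by fun_prop)]
  simp_rw [← pointSum_const_mul, ← pointSum_finset_sum]
  rw [lintegral_expNeg_pointSum μ (by fun_prop)]
  simp_rw [hpt, expNeg_sum]
  rw [lintegral_finsetSum _ (by fun_prop), expNeg_sum]
  have hind := iIndepFun_pi (μ := fun i ↦ (poissonProcessLaw μ).map (pointSum (f i)))
    (X := fun i x ↦ expNeg ((z i : ℝ≥0∞) * x)) (fun i ↦ Measurable.aemeasurable (by fun_prop))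
  rw [lintegral_prod_eq_prod_lintegral_of_indepFun _ _ hind (fun i ↦ by fun_prop)]
  refine Finset.prod_congr rfl fun i _ ↦ ?_
  rw [← lintegral_expNeg_pointSum μ (by fun_prop)]
  simp_rw [pointSum_const_mul]
  rw [← lintegral_map (f := fun x ↦ expNeg ((z i : ℝ≥0∞) * x)) (by fun_prop) (hm i),
    ← (measurePreserving_eval (fun i ↦ (poissonProcessLaw μ).map (pointSum (f i))) i).map_eq,
    lintegral_map (by fun_prop) (by fun_prop)]

/-! ### Construction of the subordinator from drift and Poissonian jumps. -/

/-- The size of the jump at the point `p = (time, size)` if its time lies in `(s, t]`. -/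
noncomputable def jumpIn (s t : ℝ≥0) (p : ℝ × ℝ≥0∞) : ℝ≥0∞ :=
  {q : ℝ × ℝ≥0∞ | q.1 ∈ Set.Ioc (s : ℝ) t}.indicator Prod.snd p

@[fun_prop] lemma measurable_jumpIn (s t : ℝ≥0) : Measurable (jumpIn s t) :=
  measurable_snd.indicator (measurable_fst measurableSet_Ioc)

lemma jumpIn_self (s : ℝ≥0) : jumpIn s s = fun _ ↦ 0 := by ext; simp [jumpIn]

lemma jumpIn_add {s t u : ℝ≥0} (hst : s ≤ t) (htu : t ≤ u) (p : ℝ × ℝ≥0∞) :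
    jumpIn s u p = jumpIn s t p + jumpIn t u p := by
  have h1 : (s : ℝ) ≤ t := hst
  have h2 : (t : ℝ) ≤ u := htu
  simp only [jumpIn, Set.indicator_apply, Set.mem_ofPred_eq, Set.mem_Ioc]
  by_cases ha : p.1 ≤ t
  · have hb : ¬ (t : ℝ) < p.1 := not_lt.2 ha
    simp [ha, hb, ha.trans h2]
  · have hb : (t : ℝ) < p.1 := not_le.1 ha
    simp [ha, hb, h1.trans_lt hb]

lemma lintegral_one_sub_expNeg_jumpIn (ρ : Measure ℝ≥0∞) [SFinite ρ] (s t z : ℝ≥0) :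
    ∫⁻ p, (1 - expNeg (z * jumpIn s t p)) ∂((volume : Measure ℝ).prod ρ) =
      ((t - s : ℝ≥0) : ℝ≥0∞) * ∫⁻ r, (1 - expNeg (z * r)) ∂ρ := by
  have h (p : ℝ × ℝ≥0∞) : 1 - expNeg (z * jumpIn s t p) =
      (Set.Ioc (s : ℝ) t).indicator 1 p.1 * (1 - expNeg (z * p.2)) := by
    by_cases hp : p.1 ∈ Set.Ioc (s : ℝ) t
    · simp [jumpIn, hp, -Set.mem_Ioc]
    · simp [jumpIn, hp, -Set.mem_Ioc]
  simp_rw [h]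
  rw [lintegral_prod_mul (f := (Set.Ioc (s : ℝ) t).indicator 1)
      (g := fun r : ℝ≥0∞ ↦ 1 - expNeg (z * r))
      ((measurable_one.indicator measurableSet_Ioc).aemeasurable)
      (Measurable.aemeasurable (by fun_prop)),
    lintegral_indicator_one measurableSet_Ioc, Real.volume_Ioc]
  rfl

/-- The increment over `(s, t]` of the process with drift `γ` and Poissonian jumps. -/
noncomputable def levyIncrement (γ s t : ℝ≥0) (ω : ℕ → Σ n : ℕ, Fin n → ℝ × ℝ≥0∞) : ℝ≥0∞ :=
  ((γ * (t - s) : ℝ≥0) : ℝ≥0∞) + pointSum (jumpIn s t) ω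

@[fun_prop] lemma measurable_levyIncrement (γ s t : ℝ≥0) : Measurable (levyIncrement γ s t) :=
  (measurable_pointSum (measurable_jumpIn s t)).const_add _

lemma levyIncrement_self (γ s : ℝ≥0) (ω : ℕ → Σ n : ℕ, Fin n → ℝ × ℝ≥0∞) :
    levyIncrement γ s s ω = 0 := by
  simp [levyIncrement, jumpIn_self, pointSum_zero]

lemma levyIncrement_add (γ : ℝ≥0) {s t u : ℝ≥0} (hst : s ≤ t) (htu : t ≤ u)
    (ω : ℕ → Σ n : ℕ, Fin n → ℝ × ℝ≥0∞) :
    levyIncrement γ s u ω = levyIncrement γ s t ω + levyIncrement γ t u ω := by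
  have h : jumpIn s u = fun p ↦ jumpIn s t p + jumpIn t u p := funext (jumpIn_add hst htu)
  have h' : u - s = (t - s) + (u - t) := by
    rw [add_comm, tsub_add_tsub_cancel htu hst]
  rw [levyIncrement, levyIncrement, levyIncrement, h, pointSum_add, h', mul_add, ENNReal.coe_add]
  ring

lemma levyIncrement_eq_sum (γ : ℝ≥0) {τ : ℕ → ℝ≥0} (hτ : Monotone τ) (n : ℕ)
    (ω : ℕ → Σ n : ℕ, Fin n → ℝ × ℝ≥0∞) :
    levyIncrement γ (τ 0) (τ n) ω =
      ∑ i ∈ Finset.range n, levyIncrement γ (τ i) (τ (i + 1)) ω := by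
  induction n with
  | zero => simp [levyIncrement_self]
  | succ n ih =>
    rw [Finset.sum_range_succ, ← ih, ← levyIncrement_add γ (hτ n.zero_le) (hτ n.le_succ)]

section

variable (γ : ℝ≥0) (ρ : Measure ℝ≥0∞) [SFinite ρ]

/-- The law of the jump times and sizes when the sizes have intensity `ρ`. -/
noncomputable def jumpLaw : Measure (ℕ → Σ n : ℕ, Fin n → ℝ × ℝ≥0∞) :=
  poissonProcessLaw ((volume : Measure ℝ).prod ρ)

instance : IsProbabilityMeasure (jumpLaw ρ) := by unfold jumpLaw; infer_instance

lemma lintegral_expNeg_levyIncrement (s t z : ℝ≥0) :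
    ∫⁻ ω, expNeg (z * levyIncrement γ s t ω) ∂jumpLaw ρ =
      expNeg ((t - s : ℝ≥0) * (γ * z + ∫⁻ r, (1 - expNeg (z * r)) ∂ρ)) := by
  simp_rw [levyIncrement, mul_add, expNeg_add]
  rw [lintegral_const_mul _ (by fun_prop)]
  simp_rw [← pointSum_const_mul]
  rw [jumpLaw, lintegral_expNeg_pointSum _ (by fun_prop), lintegral_one_sub_expNeg_jumpIn]
  congr 2
  push_cast
  ring

lemma map_levyIncrement (s t : ℝ≥0) :
    (jumpLaw ρ).map (levyIncrement γ t (t + s)) = (jumpLaw ρ).map (levyIncrement γ 0 s) := by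
  have := fun s t ↦ Measure.isProbabilityMeasure_map (μ := jumpLaw ρ)
    (measurable_levyIncrement γ s t).aemeasurable
  refine Measure.ext_of_laplace_one fun z ↦ ?_
  rw [lintegral_map (by fun_prop) (by fun_prop), lintegral_map (by fun_prop) (by fun_prop),
    lintegral_expNeg_levyIncrement, lintegral_expNeg_levyIncrement]
  simp

/-- The windows `(τ i, τ (i+1)]` are disjoint, so the jump functions have disjoint supports; the
drift is deterministic. -/
lemma iIndepFun_levyIncrement {τ : ℕ → ℝ≥0} (hτ : Monotone τ) (m : ℕ) :
    iIndepFun (fun i : Fin m ↦ levyIncrement γ (τ i) (τ (i + 1))) (jumpLaw ρ) := by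
  have h : iIndepFun (fun i : Fin m ↦ pointSum (jumpIn (τ i) (τ (i + 1)))) (jumpLaw ρ) := by
    refine iIndepFun_pointSum _ (fun i ↦ by fun_prop) fun p i j hij ↦ ?_
    wlog hlt : i < j generalizing i j
    · exact (this j i hij.symm (lt_of_le_of_ne (not_lt.1 hlt) hij.symm)).symm
    have hle : (τ (i + 1) : ℝ) ≤ τ j := hτ (Nat.succ_le_of_lt hlt)
    by_cases hp : p.1 ≤ τ (i + 1)
    · right
      simp only [jumpIn, Set.indicator_apply_eq_zero, Set.mem_ofPred_eq, Set.mem_Ioc]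
      exact fun h ↦ absurd (hp.trans hle) (not_le.2 h.1)
    · left
      simp only [jumpIn, Set.indicator_apply_eq_zero, Set.mem_ofPred_eq, Set.mem_Ioc]
      exact fun h ↦ absurd h.2 hp
  exact h.comp (fun i x ↦ ((γ * (τ (i + 1) - τ i) : ℝ≥0) : ℝ≥0∞) + x) fun i ↦ by fun_prop

/-- An almost surely infinite increment would have Laplace transform `0` at `z = 1`, yet the
exponent there is finite. This makes the conditional measures below genuine probabilities. -/
lemma measure_levyIncrement_lt_top_ne_zero (hρ : ∫⁻ r, (1 - expNeg r) ∂ρ ≠ ∞) (s t : ℝ≥0) :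
    jumpLaw ρ {ω | levyIncrement γ s t ω < ∞} ≠ 0 := by
  intro h
  have h1 := lintegral_expNeg_levyIncrement γ ρ s t 1
  have h0 : ∫⁻ ω, expNeg ((1 : ℝ≥0) * levyIncrement γ s t ω) ∂jumpLaw ρ = 0 := by
    rw [lintegral_eq_zero_iff (by fun_prop)]
    have : ∀ᵐ ω ∂jumpLaw ρ, ¬ levyIncrement γ s t ω < ∞ := by simpa only [ae_iff, not_not] using h
    filter_upwards [this] with ω hω
    simp [not_lt_top_iff.1 hω]
  rw [h0, ← expNeg_top] at h1
  refine (ENNReal.mul_ne_top ENNReal.coe_ne_top (ENNReal.add_ne_top.2 ⟨?_, ?_⟩))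
    (expNeg_strictAnti.injective h1).symm
  · simp
  · simpa using hρ

/-- On the conditioning event the truncated difference is the increment over `(t, t+s]`, which is
independent of that event, so conditioning leaves its law unchanged. -/
lemma map_cond_levyIncrement (hρ : ∫⁻ r, (1 - expNeg r) ∂ρ ≠ ∞) (t s : ℝ≥0) :
    ((jumpLaw ρ)[|{ω | levyIncrement γ 0 t ω < ∞}]).map
      (fun ω ↦ levyIncrement γ 0 (t + s) ω - levyIncrement γ 0 t ω) =
      (jumpLaw ρ).map (levyIncrement γ 0 s) := by
  have hA : MeasurableSet {ω | levyIncrement γ 0 t ω < ∞} :=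
    measurableSet_lt (by fun_prop) measurable_const
  have hae : (fun ω ↦ levyIncrement γ 0 (t + s) ω - levyIncrement γ 0 t ω)
      =ᵐ[(jumpLaw ρ)[|{ω | levyIncrement γ 0 t ω < ∞}]] levyIncrement γ t (t + s) := by
    filter_upwards [ae_cond_mem hA] with ω hω
    rw [levyIncrement_add γ (zero_le (a := t)) (le_self_add (a := t) (b := s)),
      ENNReal.add_sub_cancel_left (ne_of_lt hω)]
  have hτ : Monotone fun n : ℕ ↦ if n = 0 then 0 else if n = 1 then t else t + s := by
    refine monotone_nat_of_le_succ fun n ↦ ?_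
    rcases n with _ | _ | n <;> simp
  have hind : IndepFun (levyIncrement γ 0 t) (levyIncrement γ t (t + s)) (jumpLaw ρ) := by
    simpa using (iIndepFun_levyIncrement γ ρ hτ 2).indepFun (i := 0) (j := 1) (by simp)
  rw [Measure.map_congr hae, ← map_levyIncrement γ ρ s t]
  ext B hB
  have hAB : jumpLaw ρ ({ω | levyIncrement γ 0 t ω < ∞} ∩ levyIncrement γ t (t + s) ⁻¹' B) =
      jumpLaw ρ {ω | levyIncrement γ 0 t ω < ∞} * jumpLaw ρ (levyIncrement γ t (t + s) ⁻¹' B) :=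
    hind.measure_inter_preimage_eq_mul (Set.Iio ∞) B measurableSet_Iio hB
  rw [Measure.map_apply (by fun_prop) hB, Measure.map_apply (by fun_prop) hB, cond_apply hA,
    hAB, ← mul_assoc, ENNReal.inv_mul_cancel (measure_levyIncrement_lt_top_ne_zero γ ρ hρ 0 t)
      (measure_ne_top _ _), one_mul]

/-- The value at `t n` is finite exactly when each earlier increment is, so the conditioning event
is an intersection of one event per increment, and such conditioning preserves independence. -/
lemma iIndepFun_cond_levyIncrement (hρ : ∫⁻ r, (1 - expNeg r) ∂ρ ≠ ∞) {t : ℕ → ℝ≥0}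
    (ht : Monotone t) (n : ℕ) :
    iIndepFun (fun (i : Fin (n + 1)) ω ↦
        levyIncrement γ 0 (t (i + 1)) ω - levyIncrement γ 0 (t i) ω)
      ((jumpLaw ρ)[|{ω | levyIncrement γ 0 (t n) ω < ∞}]) := by
  have hA : MeasurableSet {ω | levyIncrement γ 0 (t n) ω < ∞} :=
    measurableSet_lt (by fun_prop) measurable_const
  -- Time 0 is prepended so that the value at `t n` is the sum of the first `n + 1` increments; the
  -- last one, after `t n`, is unconstrained, whence `Set.univ` in `B`.
  let τ : ℕ → ℝ≥0 := fun k ↦ k.casesOn 0 t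
  have hτ : Monotone τ := by
    refine monotone_nat_of_le_succ fun k ↦ ?_
    rcases k with _ | k
    · exact zero_le
    · exact ht k.le_succ
  let Z : Fin (n + 2) → (ℕ → Σ n : ℕ, Fin n → ℝ × ℝ≥0∞) → ℝ≥0∞ :=
    fun i ↦ levyIncrement γ (τ i) (τ (i + 1))
  have hZm (i : Fin (n + 2)) : Measurable (Z i) := measurable_levyIncrement _ _ _
  let B : Fin (n + 2) → Set ℝ≥0∞ := fun i ↦ if i = Fin.last (n + 1) then Set.univ else Set.Iio ∞
  have hAB : {ω | levyIncrement γ 0 (t n) ω < ∞} = ⋂ i, Z i ⁻¹' B i := by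
    ext ω
    have hsum := levyIncrement_eq_sum γ hτ (n + 1) ω
    rw [Finset.sum_range] at hsum
    change levyIncrement γ (τ 0) (τ (n + 1)) ω < ∞ ↔ _
    rw [Set.mem_iInter, Fin.forall_fin_succ', hsum, ENNReal.sum_lt_top]
    simp [B, Z, Fin.castSucc_ne_last]
  have hind : iIndepFun (fun i ω ↦ (Z i ω, Z i ω)) (jumpLaw ρ) :=
    (iIndepFun_levyIncrement γ ρ hτ (n + 2)).comp (fun _ x ↦ (x, x)) fun _ ↦ by fun_prop
  have hcond : iIndepFun Z ((jumpLaw ρ)[|{ω | levyIncrement γ 0 (t n) ω < ∞}]) := by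
    rw [hAB]
    refine hind.cond hZm (fun i ↦ ?_) fun i ↦ ?_
    · refine fun h ↦ measure_levyIncrement_lt_top_ne_zero γ ρ hρ (τ i) (τ (i + 1))
        (measure_mono_null (fun ω hω ↦ ?_) h)
      simp only [B, Set.mem_preimage]
      split_ifs
      · trivial
      · exact hω
    · simp only [B]; split_ifs <;> measurability
  -- The added increment over `(0, t 0]` is dropped again.
  refine (hcond.precomp (Fin.succ_injective (n + 1))).congr fun i ↦ ?_
  filter_upwards [ae_cond_mem hA] with ω hω
  have hle : t i ≤ t n := ht (Nat.lt_succ_iff.1 i.2)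
  have hfin : levyIncrement γ 0 (t i) ω ≠ ∞ := by
    refine ne_top_of_le_ne_top (ne_of_lt hω) ?_
    rw [levyIncrement_add γ zero_le hle]
    exact le_self_add
  rw [levyIncrement_add γ zero_le (ht (Nat.le_succ i)), ENNReal.add_sub_cancel_left hfin]
  simp [Z, τ]

/-- Markov's inequality for `1 - e^{-X_t}`, whose mean `1 - e^{-tK}` vanishes as `t → 0`. -/
lemma tendsto_measure_levyIncrement_gt (hρ : ∫⁻ r, (1 - expNeg r) ∂ρ ≠ ∞) {ε : ℝ≥0∞}
    (hε : 0 < ε) :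
    Tendsto (fun t : ℝ≥0 ↦ jumpLaw ρ {ω | ε < levyIncrement γ 0 t ω}) (𝓝[>] 0) (𝓝 0) := by
  have hK : (γ : ℝ≥0∞) + ∫⁻ r, (1 - expNeg r) ∂ρ ≠ ∞ :=
    ENNReal.add_ne_top.2 ⟨ENNReal.coe_ne_top, hρ⟩
  set K := (γ : ℝ≥0∞) + ∫⁻ r, (1 - expNeg r) ∂ρ with hKdef
  have hpos : 1 - expNeg ε ≠ 0 := by
    rw [Ne, tsub_eq_zero_iff_le, not_le, ← expNeg_zero]
    exact expNeg_strictAnti hε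
  have hbound (t : ℝ≥0) : jumpLaw ρ {ω | ε < levyIncrement γ 0 t ω} ≤
      (1 - expNeg (t * K)) / (1 - expNeg ε) := by
    have hlap := lintegral_expNeg_levyIncrement γ ρ 0 t 1
    simp only [ENNReal.coe_one, one_mul, tsub_zero, mul_one, ← hKdef] at hlap
    have hint : ∫⁻ ω, (1 - expNeg (levyIncrement γ 0 t ω)) ∂jumpLaw ρ = 1 - expNeg (t * K) := by
      rw [lintegral_sub (by fun_prop) (by rw [hlap]; exact expNeg_ne_top _)
        (ae_of_all _ fun ω ↦ expNeg_le_one _), hlap]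
      simp
    rw [← hint]
    refine le_trans (measure_mono fun ω hω ↦ ?_) (meas_ge_le_lintegral_div (by fun_prop) hpos
      (ne_top_of_le_ne_top ENNReal.one_ne_top tsub_le_self))
    exact tsub_le_tsub_left (expNeg_strictAnti.antitone (le_of_lt hω)) _
  have hlim : Tendsto (fun t : ℝ≥0 ↦ (1 - expNeg (t * K)) / (1 - expNeg ε)) (𝓝 0) (𝓝 0) := by
    have h1 : Tendsto (fun t : ℝ≥0 ↦ expNeg (t * K)) (𝓝 0) (𝓝 1) := by
      have : Continuous fun t : ℝ≥0 ↦ expNeg (t * K) := continuous_expNeg.comp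
        ((ENNReal.continuous_mul_const hK).comp ENNReal.continuous_coe)
      simpa using this.tendsto 0
    have h2 := ENNReal.Tendsto.div_const (ENNReal.Tendsto.sub
      (tendsto_const_nhds (x := (1 : ℝ≥0∞))) h1 (Or.inl ENNReal.one_ne_top))
      (b := 1 - expNeg ε) (Or.inr hpos)
    simpa using h2
  exact tendsto_of_tendsto_of_tendsto_of_le_of_le tendsto_const_nhds
    (hlim.mono_left nhdsWithin_le_nhds) (fun _ ↦ zero_le) hbound

/-- Drift plus Poissonian jumps is a subordinator. -/
theorem isSubordinator_levyIncrement (hρ : ∫⁻ r, (1 - expNeg r) ∂ρ ≠ ∞) :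
    IsSubordinator (fun t ↦ levyIncrement γ 0 t) (jumpLaw ρ) where
  measurable _ := by fun_prop
  increment_nonneg t s := ae_of_all _ fun ω ↦ by
    rw [levyIncrement_add γ (zero_le (a := t)) (le_self_add (a := t) (b := s))]
    exact le_self_add
  stationary_increments := map_cond_levyIncrement γ ρ hρ
  independent_increments _ ht n := iIndepFun_cond_levyIncrement γ ρ hρ ht n
  start_zero := ae_of_all _ fun ω ↦ levyIncrement_self γ 0 ω
  stochastic_continuity _ hε := tendsto_measure_levyIncrement_gt γ ρ hρ hε

end

/-! ### From the Lévy–Khintchine formula to the jump intensity. -/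

/-- The bound `1 - e^{-rz} ≤ max(z,1) min(r,1)` gives integrability, so the Bochner integral is not
the default value 0. -/
lemma lintegral_one_sub_expNeg_ofReal {ν : Measure ℝ}
    (hν : ∫⁻ r in Set.Ioi 0, ENNReal.ofReal (min r 1) ∂ν < ∞) (z : ℝ≥0) :
    ∫⁻ r in Set.Ioi 0, (1 - expNeg (z * ENNReal.ofReal r)) ∂ν =
      ENNReal.ofReal (∫ r in Set.Ioi (0 : ℝ), (1 - Real.exp (-(r * z))) ∂ν) := by
  have heq : ∀ r ∈ Set.Ioi (0 : ℝ), 1 - expNeg (z * ENNReal.ofReal r) =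
      ENNReal.ofReal (1 - Real.exp (-(r * z))) := by
    intro r (hr : 0 < r)
    rw [← ENNReal.ofReal_coe_nnreal, ← ENNReal.ofReal_mul z.coe_nonneg,
      expNeg_ofReal (by positivity), ENNReal.ofReal_sub _ (Real.exp_nonneg _),
      ENNReal.ofReal_one, mul_comm]
  have hnn : 0 ≤ᵐ[ν.restrict (Set.Ioi 0)] fun r : ℝ ↦ 1 - Real.exp (-(r * z)) := by
    filter_upwards [ae_restrict_mem measurableSet_Ioi] with r (hr : 0 < r)
    have : 0 ≤ r * z := by positivity
    simpa using this
  have hint : Integrable (fun r : ℝ ↦ 1 - Real.exp (-(r * z))) (ν.restrict (Set.Ioi 0)) := by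
    refine ⟨Measurable.aestronglyMeasurable (by fun_prop), ?_⟩
    rw [hasFiniteIntegral_iff_ofReal hnn]
    calc ∫⁻ r in Set.Ioi 0, ENNReal.ofReal (1 - Real.exp (-(r * z))) ∂ν
        ≤ ∫⁻ r in Set.Ioi 0, ENNReal.ofReal (max (z : ℝ) 1) * ENNReal.ofReal (min r 1) ∂ν := by
          refine setLIntegral_mono' measurableSet_Ioi fun r (hr : 0 < r) ↦ ?_
          rw [← ENNReal.ofReal_mul (by positivity)]
          refine ENNReal.ofReal_le_ofReal ?_
          have h1 : 1 - Real.exp (-(r * z)) ≤ r * z := by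
            linarith [Real.add_one_le_exp (-(r * z))]
          have h2 : 1 - Real.exp (-(r * z)) ≤ 1 := by linarith [Real.exp_nonneg (-(r * z))]
          rcases le_total r 1 with h | h
          · rw [min_eq_left h]
            nlinarith [le_max_left (z : ℝ) 1]
          · rw [min_eq_right h]
            linarith [le_max_right (z : ℝ) 1]
      _ = ENNReal.ofReal (max (z : ℝ) 1) * ∫⁻ r in Set.Ioi 0, ENNReal.ofReal (min r 1) ∂ν :=
          lintegral_const_mul _ (by fun_prop)
      _ < ∞ := ENNReal.mul_lt_top ENNReal.ofReal_lt_top hν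
  rw [setLIntegral_congr_fun measurableSet_Ioi heq, ofReal_integral_eq_lintegral_ofReal hint hnn]

/-- The density `min(r,1)` turns `ν` into a finite measure and is positive on `(0,∞)`, so dividing
by it recovers `ν`. The Poisson construction needs this. -/
lemma sFinite_restrict_Ioi {ν : Measure ℝ}
    (hν : ∫⁻ r in Set.Ioi 0, ENNReal.ofReal (min r 1) ∂ν < ∞) :
    SFinite (ν.restrict (Set.Ioi 0)) := by
  have hm : Measurable fun r : ℝ ↦ ENNReal.ofReal (min r 1) := by fun_prop
  rw [← withDensity_inv_same (μ := ν.restrict (Set.Ioi 0)) hm ?_ (ae_of_all _ fun _ ↦ ENNReal.ofReal_ne_top)]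
  · have := isFiniteMeasure_withDensity hν.ne
    infer_instance
  · filter_upwards [ae_restrict_mem measurableSet_Ioi] with r (hr : 0 < r)
    simpa using hr

/-- The law of the jump sizes, killing being a jump to `∞`. -/
noncomputable def jumpSizeMeasure (c : ℝ≥0) (ν : Measure ℝ) : Measure ℝ≥0∞ :=
  (ν.restrict (Set.Ioi 0)).map ENNReal.ofReal + c • Measure.dirac ∞

lemma HasLevyTriple.coe_eq {G : ℝ≥0 → ℝ≥0} {c γ : ℝ≥0} {ν : Measure ℝ}
    (h : HasLevyTriple G c γ ν) (z : ℝ≥0) :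
    (G z : ℝ≥0∞) = γ * z + ∫⁻ r, (1 - expNeg (z * r)) ∂jumpSizeMeasure c ν := by
  have hnn : 0 ≤ ∫ r in Set.Ioi (0 : ℝ), (1 - Real.exp (-(r * z))) ∂ν := by
    refine setIntegral_nonneg measurableSet_Ioi fun r (hr : 0 < r) ↦ ?_
    have : 0 ≤ r * z := by positivity
    simpa using this
  rw [jumpSizeMeasure, lintegral_add_measure, lintegral_map (by fun_prop) (by fun_prop),
    lintegral_one_sub_expNeg_ofReal h.lintegral_min_lt_top, lintegral_smul_measure,
    lintegral_dirac, ← ENNReal.ofReal_coe_nnreal, h.eq z, ENNReal.ofReal_add (by positivity) hnn,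
    ENNReal.ofReal_add (by positivity) (by positivity), ENNReal.ofReal_mul γ.coe_nonneg,
    ENNReal.ofReal_mul c.coe_nonneg]
  -- The atom at `∞` contributes `c (1 - e^{-z·∞})`; since `0 · ∞ = 0`, this is `c 𝟙_{z > 0}`.
  rcases eq_or_ne z 0 with rfl | hz
  · simp
  · have hz' : 0 < z := pos_iff_ne_zero.2 hz
    simp [hz, hz', ENNReal.smul_def]
    ring

/-- Every function of the Lévy class is the Laplace exponent of a subordinator. -/
theorem exists_isSubordinator {G : ℝ≥0 → ℝ≥0} (hG : G ∈ LevyClass) :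
    ∃ (Ω : Type) (_ : MeasurableSpace Ω) (P : Measure Ω) (X : ℝ≥0 → Ω → ℝ≥0∞),
      IsProbabilityMeasure P ∧ IsSubordinator X P ∧ HasLaplaceExponent X P G := by
  obtain ⟨c, γ, ν, h⟩ := hG
  have := sFinite_restrict_Ioi h.lintegral_min_lt_top
  have : SFinite (jumpSizeMeasure c ν) := by unfold jumpSizeMeasure; infer_instance
  -- Finiteness of this integral is read off from the finiteness of `G 1`.
  have hρ : ∫⁻ r, (1 - expNeg r) ∂jumpSizeMeasure c ν ≠ ∞ := by
    have h1 := h.coe_eq 1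
    simp only [ENNReal.coe_one, one_mul] at h1
    exact ne_top_of_le_ne_top (h1 ▸ ENNReal.coe_ne_top) le_add_self
  refine ⟨_, _, jumpLaw (jumpSizeMeasure c ν), fun t ↦ levyIncrement γ 0 t, inferInstance,
    isSubordinator_levyIncrement γ _ hρ, fun t z ↦ ?_⟩
  have := lintegral_expNeg_levyIncrement γ (jumpSizeMeasure c ν) 0 t z
  rw [← h.coe_eq z, tsub_zero, ← ENNReal.coe_mul, expNeg_coe] at this
  simpa [expNeg] using this

/-! ### Exponential and uniform laws on the extended half-line. -/

lemma HasLaplaceExponent.lintegral_expNeg {Ω : Type*} [MeasurableSpace Ω] {P : Measure Ω}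
    {X : ℝ≥0 → Ω → ℝ≥0∞} {G : ℝ≥0 → ℝ≥0} (h : HasLaplaceExponent X P G) (t z : ℝ≥0) :
    ∫⁻ ω, expNeg (z * X t ω) ∂P = expNeg (t * G z) := by
  rw [← ENNReal.coe_mul, expNeg_coe]
  simpa [expNeg] using h t z

lemma inducedLevel_mono {Ω : Type*} [MeasurableSpace Ω] (P : Measure Ω) (X : ℝ≥0 → Ω → ℝ≥0∞)
    {a a' b b' : ℝ} (ha : a ≤ a') (hb : b ≤ b') :
    inducedLevel X P a b ≤ inducedLevel X P a' b' :=
  iInf_mono fun _ ↦ iInf_mono' fun h ↦ ⟨(ENNReal.ofReal_le_ofReal hb).trans (h.trans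
    (measure_mono fun _ hω ↦ (ENNReal.ofReal_le_ofReal ha).trans hω)), le_rfl⟩

lemma expMeasure_Iic {r x : ℝ} (hr : 0 < r) (hx : 0 ≤ x) :
    expMeasure r (Set.Iic x) = ENNReal.ofReal (1 - Real.exp (-(r * x))) := by
  have := isProbabilityMeasure_expMeasure hr
  rw [← ofReal_cdf, cdf_expMeasure_eq hr, if_pos hx]

instance (r : ℝ) : NullSingletonClass (expMeasure r) := by
  unfold expMeasure gammaMeasure; infer_instance

lemma one_sub_expNeg_ofReal {x : ℝ} (hx : 0 ≤ x) :
    1 - expNeg (ENNReal.ofReal x) = ENNReal.ofReal (1 - Real.exp (-x)) := by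
  rw [expNeg_ofReal hx, ENNReal.ofReal_sub _ (Real.exp_nonneg _), ENNReal.ofReal_one]

lemma expMeasure_ofReal_le {r : ℝ≥0} (hr : 0 < r) (x : ℝ≥0∞) :
    expMeasure r {y | ENNReal.ofReal y ≤ x} = 1 - expNeg (r * x) := by
  have := isProbabilityMeasure_expMeasure (NNReal.coe_pos.2 hr)
  induction x with
  | top => simp [hr.ne']
  | coe x =>
    have h : {y : ℝ | ENNReal.ofReal y ≤ x} = Set.Iic (x : ℝ) := by
      ext y; simp [ENNReal.ofReal_le_coe]
    rw [h, expMeasure_Iic (NNReal.coe_pos.2 hr) x.coe_nonneg, ← one_sub_expNeg_ofReal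
      (by positivity), ENNReal.ofReal_mul r.coe_nonneg, ENNReal.ofReal_coe_nnreal,
      ENNReal.ofReal_coe_nnreal]

lemma expMeasure_ofReal_lt {r : ℝ≥0} (hr : 0 < r) (x : ℝ≥0∞) :
    expMeasure r {y | ENNReal.ofReal y < x} = 1 - expNeg (r * x) := by
  have := isProbabilityMeasure_expMeasure (NNReal.coe_pos.2 hr)
  induction x with
  | top => simp [hr.ne']
  | coe x =>
    rcases eq_or_ne x 0 with rfl | hx
    · simp
    have hx' : 0 < x := pos_iff_ne_zero.2 hx
    have h : {y : ℝ | ENNReal.ofReal y < x} = Set.Iio (x : ℝ) := by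
      ext y
      rw [Set.mem_ofPred_eq, ← ENNReal.ofReal_coe_nnreal,
        ENNReal.ofReal_lt_ofReal_iff (NNReal.coe_pos.2 hx'), Set.mem_Iio]
    rw [h, measure_congr Iio_ae_eq_Iic, expMeasure_Iic (NNReal.coe_pos.2 hr) x.coe_nonneg,
      ← one_sub_expNeg_ofReal (by positivity), ENNReal.ofReal_mul r.coe_nonneg,
      ENNReal.ofReal_coe_nnreal, ENNReal.ofReal_coe_nnreal]

/-- The formula also covers rate 0 at `x = ∞`, where `0 · ∞ = 0` makes both sides vanish. -/
lemma extExpLaw_Iio (r : ℝ≥0) (x : ℝ≥0∞) :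
    extExpLaw r (Set.Iio x) = 1 - expNeg (r * x) := by
  rcases eq_or_ne r 0 with rfl | hr
  · simp [extExpLaw]
  · rw [extExpLaw, if_neg hr, Measure.map_apply (by fun_prop) measurableSet_Iio,
      ← expMeasure_ofReal_lt (pos_iff_ne_zero.2 hr)]
    rfl

instance (r : ℝ≥0) : IsProbabilityMeasure (extExpLaw r) := by
  rw [extExpLaw]
  split_ifs with h
  · infer_instance
  · have := isProbabilityMeasure_expMeasure (NNReal.coe_pos.2 (pos_iff_ne_zero.2 h))
    exact Measure.isProbabilityMeasure_map (by fun_prop)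

lemma uniform_ofReal_le {u : ℝ≥0∞} (hu : u ≤ 1) :
    (volume.restrict (Set.Ioo (0 : ℝ) 1)) {b | ENNReal.ofReal b ≤ u} = u := by
  have hu' : u ≠ ∞ := ne_top_of_le_ne_top ENNReal.one_ne_top hu
  lift u to ℝ≥0 using hu'
  have hu1 : (u : ℝ) ≤ 1 := by exact_mod_cast hu
  have h : {b : ℝ | ENNReal.ofReal b ≤ u} = Set.Iic (u : ℝ) := by
    ext y; simp [ENNReal.ofReal_le_coe]
  have h2 : Set.Iic (u : ℝ) ∩ Set.Ioc 0 1 = Set.Ioc 0 (u : ℝ) := by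
    ext y; simp only [Set.mem_inter_iff, Set.mem_Iic, Set.mem_Ioc]
    exact ⟨fun h ↦ ⟨h.2.1, h.1⟩, fun h ↦ ⟨h.2, h.1, h.2.trans hu1⟩⟩
  rw [restrict_Ioo_eq_restrict_Ioc, h, Measure.restrict_apply measurableSet_Iic, h2,
    Real.volume_Ioc, sub_zero, ENNReal.ofReal_coe_nnreal]

lemma MeasureTheory.Measure.ext_of_Iio {μ ν : Measure ℝ≥0∞} [IsProbabilityMeasure μ]
    [IsProbabilityMeasure ν] (h : ∀ x, μ (Set.Iio x) = ν (Set.Iio x)) : μ = ν := by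
  refine Measure.ext_of_Ici μ ν fun x ↦ ?_
  rw [← Set.compl_Iio, prob_compl_eq_one_sub measurableSet_Iio,
    prob_compl_eq_one_sub measurableSet_Iio, h]

/-! ### The level function: uniqueness, finiteness, measurability and the `G`-transformation. -/

section

variable {Ω : Type*} [MeasurableSpace Ω] {P : Measure Ω}
  {X : ℝ≥0 → Ω → ℝ≥0∞} {G : ℝ≥0 → ℝ≥0}

lemma HasLaplaceExponent.map_eq [IsProbabilityMeasure P] {Ω' : Type*} [MeasurableSpace Ω'] {P' : Measure Ω'}
    [IsProbabilityMeasure P'] {X' : ℝ≥0 → Ω' → ℝ≥0∞} (h : HasLaplaceExponent X P G)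
    (h' : HasLaplaceExponent X' P' G) (hX : IsSubordinator X P) (hX' : IsSubordinator X' P')
    (t : ℝ≥0) : P.map (X t) = P'.map (X' t) := by
  have hm := hX.measurable t
  have hm' := hX'.measurable t
  have := Measure.isProbabilityMeasure_map (μ := P) hm.aemeasurable
  have := Measure.isProbabilityMeasure_map (μ := P') hm'.aemeasurable
  refine Measure.ext_of_laplace_one fun z ↦ ?_
  rw [lintegral_map (by fun_prop) hm, lintegral_map (by fun_prop) hm', h.lintegral_expNeg,
    h'.lintegral_expNeg]

lemma HasLaplaceExponent.inducedLevel_eq [IsProbabilityMeasure P] {Ω' : Type*} [MeasurableSpace Ω'] {P' : Measure Ω'}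
    [IsProbabilityMeasure P'] {X' : ℝ≥0 → Ω' → ℝ≥0∞} (h : HasLaplaceExponent X P G)
    (h' : HasLaplaceExponent X' P' G) (hX : IsSubordinator X P) (hX' : IsSubordinator X' P')
    (a b : ℝ) : inducedLevel X P a b = inducedLevel X' P' a b := by
  have (t : ℝ≥0) : P {ω | ENNReal.ofReal a ≤ X t ω} = P' {ω | ENNReal.ofReal a ≤ X' t ω} := by
    have := congrArg (fun μ ↦ μ (Set.Ici (ENNReal.ofReal a))) (h.map_eq h' hX hX' t)
    rwa [Measure.map_apply (hX.measurable t) measurableSet_Ici,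
      Measure.map_apply (hX'.measurable t) measurableSet_Ici] at this
  simp_rw [inducedLevel, this]

/-- Chernoff bound: at a `z` with `G z > 0`, `P(X_n < a) ≤ e^{za - nG(z)}` eventually falls below `1
- b > 0`. -/
lemma HasLaplaceExponent.inducedLevel_lt_top [IsProbabilityMeasure P] (h : HasLaplaceExponent X P G)
    (hX : IsSubordinator X P) (hG : G ≠ 0) {a b : ℝ} (hb : b < 1) :
    inducedLevel X P a b < ∞ := by
  obtain ⟨z, hz⟩ := Function.ne_iff.1 hG
  have hz' : 0 < G z := pos_iff_ne_zero.2 hz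
  have hza : expNeg (z * ENNReal.ofReal a) ≠ 0 := by
    rw [← expNeg_top]
    exact expNeg_strictAnti.injective.ne (ENNReal.mul_ne_top ENNReal.coe_ne_top
      ENNReal.ofReal_ne_top)
  have hbound (t : ℝ≥0) : P {ω | X t ω < ENNReal.ofReal a} ≤
      expNeg (t * G z) / expNeg (z * ENNReal.ofReal a) := by
    have hm := hX.measurable t
    rw [← h.lintegral_expNeg]
    refine le_trans (measure_mono fun ω hω ↦ ?_)
      (meas_ge_le_lintegral_div (Measurable.aemeasurable (by fun_prop)) hza (expNeg_ne_top _))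
    exact expNeg_strictAnti.antitone (mul_le_mul_right (le_of_lt hω) _)
  have hlim : Tendsto (fun n : ℕ ↦ expNeg ((n : ℝ≥0) * G z) / expNeg (z * ENNReal.ofReal a))
      atTop (𝓝 0) := by
    have h1 : Tendsto (fun n : ℕ ↦ expNeg (((n : ℝ≥0) : ℝ≥0∞) * G z)) atTop (𝓝 0) := by
      rw [← expNeg_top]
      refine (continuous_expNeg.tendsto ∞).comp ?_
      have : Tendsto (fun n : ℕ ↦ ((n : ℝ≥0) : ℝ≥0∞)) atTop (𝓝 ∞) := by
        simpa using ENNReal.tendsto_nat_nhds_top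
      have := ENNReal.Tendsto.mul_const (b := (G z : ℝ≥0∞)) this (Or.inl ENNReal.top_ne_zero)
      rwa [ENNReal.top_mul (by exact_mod_cast hz'.ne')] at this
    simpa using ENNReal.Tendsto.div_const h1 (Or.inr hza)
  have hpos : 0 < 1 - ENNReal.ofReal b := by
    rw [tsub_pos_iff_lt, ENNReal.ofReal_lt_one]; exact hb
  obtain ⟨n, hn⟩ := (hlim.eventually (gt_mem_nhds hpos)).exists
  refine lt_of_le_of_lt (iInf₂_le (n : ℝ≥0) ?_) ENNReal.coe_lt_top
  have hc : {ω | ENNReal.ofReal a ≤ X n ω} = {ω | X n ω < ENNReal.ofReal a}ᶜ := by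
    ext; simp
  rw [hc, prob_compl_eq_one_sub (measurableSet_lt (hX.measurable n) measurable_const)]
  refine ENNReal.le_sub_of_add_le_left (measure_ne_top _ _) ?_
  have h2 : P {ω | X n ω < ENNReal.ofReal a} ≤ 1 - ENNReal.ofReal b := (hbound n).trans hn.le
  calc _ ≤ (1 - ENNReal.ofReal b) + ENNReal.ofReal b := by gcongr
    _ = 1 := tsub_add_cancel_of_le (ENNReal.ofReal_le_one.2 hb.le)

lemma IsSubordinator.survival_mono (hX : IsSubordinator X P) (a : ℝ) {s t : ℝ≥0} (hst : s ≤ t) :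
    P {ω | ENNReal.ofReal a ≤ X s ω} ≤ P {ω | ENNReal.ofReal a ≤ X t ω} := by
  obtain ⟨u, rfl⟩ := exists_add_of_le hst
  refine measure_mono_ae ?_
  filter_upwards [hX.increment_nonneg s u] with ω hω h
  exact le_trans h hω

/-- By monotonicity in time, any admissible time below `t` can be replaced by a later `u n`. Staying
strictly below `t` avoids any question of whether the infimum is attained, and countability yields
measurability. -/
lemma IsSubordinator.inducedLevel_lt_iff (hX : IsSubordinator X P) {t : ℝ≥0∞} {u : ℕ → ℝ≥0}
    (hu : ∀ n, (u n : ℝ≥0∞) < t) (hut : Tendsto (fun n ↦ (u n : ℝ≥0∞)) atTop (𝓝 t)) (a b : ℝ) :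
    inducedLevel X P a b < t ↔ ∃ n, ENNReal.ofReal b ≤ P {ω | ENNReal.ofReal a ≤ X (u n) ω} := by
  simp only [inducedLevel, iInf_lt_iff]
  constructor
  · rintro ⟨s, hs, hst⟩
    obtain ⟨n, hn⟩ := (hut.eventually (lt_mem_nhds hst)).exists
    exact ⟨n, hs.trans (hX.survival_mono a (by exact_mod_cast hn.le))⟩
  · rintro ⟨n, hn⟩
    exact ⟨u n, hn, hu n⟩

lemma measurable_survival (Y : Ω → ℝ≥0∞) :
    Measurable fun a : ℝ ↦ P {ω | ENNReal.ofReal a ≤ Y ω} :=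
  Antitone.measurable fun _ _ h ↦ measure_mono fun _ hω ↦ (ENNReal.ofReal_le_ofReal h).trans hω

lemma exists_nnreal_seq_lt_tendsto {t : ℝ≥0∞} (ht : 0 < t) :
    ∃ u : ℕ → ℝ≥0, Monotone u ∧ (∀ n, (u n : ℝ≥0∞) < t) ∧
      Tendsto (fun n ↦ (u n : ℝ≥0∞)) atTop (𝓝 t) := by
  obtain ⟨v, hv, hvt, hlim⟩ := exists_seq_strictMono_tendsto' ht
  have hfin (n : ℕ) : v n ≠ ∞ := (hvt n).2.ne_top
  refine ⟨fun n ↦ (v n).toNNReal, fun m n h ↦ ENNReal.toNNReal_mono (hfin n) (hv.monotone h),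
    fun n ↦ ?_, ?_⟩
  · rw [ENNReal.coe_toNNReal (hfin n)]; exact (hvt n).2
  · simpa only [ENNReal.coe_toNNReal (hfin _)] using hlim

lemma measurableSet_le_survival (Y : Ω → ℝ≥0∞) :
    MeasurableSet {p : ℝ × ℝ | ENNReal.ofReal p.2 ≤ P {ω | ENNReal.ofReal p.1 ≤ Y ω}} :=
  measurableSet_le (by fun_prop) ((measurable_survival Y).comp measurable_fst)

lemma IsSubordinator.measurable_inducedLevel (hX : IsSubordinator X P) :
    Measurable fun p : ℝ × ℝ ↦ inducedLevel X P p.1 p.2 := by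
  refine measurable_of_Iio fun t ↦ ?_
  rcases eq_or_ne t 0 with rfl | ht
  · simp
  obtain ⟨u, -, hu, hut⟩ := exists_nnreal_seq_lt_tendsto (pos_iff_ne_zero.2 ht)
  have : (fun p : ℝ × ℝ ↦ inducedLevel X P p.1 p.2) ⁻¹' Set.Iio t =
      ⋃ n, {p : ℝ × ℝ | ENNReal.ofReal p.2 ≤ P {ω | ENNReal.ofReal p.1 ≤ X (u n) ω}} := by
    ext p
    simpa using hX.inducedLevel_lt_iff hu hut p.1 p.2
  rw [this]
  exact MeasurableSet.iUnion fun n ↦ measurableSet_le_survival _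

/-- If `Y ∼ Exp(lam)` and `U` is uniform, then `P(U ≤ P(X_t ≥ Y)) = 1 - e^{-t G(lam)}`. -/
lemma HasLaplaceExponent.prod_le_survival [IsProbabilityMeasure P] (h : HasLaplaceExponent X P G)
    (hX : IsSubordinator X P) {lam : ℝ≥0} (hlam : 0 < lam) (t : ℝ≥0) :
    ((expMeasure lam).prod (volume.restrict (Set.Ioo (0 : ℝ) 1)))
      {p : ℝ × ℝ | ENNReal.ofReal p.2 ≤ P {ω | ENNReal.ofReal p.1 ≤ X t ω}} =
      1 - expNeg (t * G lam) := by
  have := isProbabilityMeasure_expMeasure (NNReal.coe_pos.2 hlam)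
  have hm := hX.measurable t
  rw [Measure.prod_apply (measurableSet_le_survival _)]
  have hslice (a : ℝ) : (volume.restrict (Set.Ioo (0 : ℝ) 1)) (Prod.mk a ⁻¹'
      {p : ℝ × ℝ | ENNReal.ofReal p.2 ≤ P {ω | ENNReal.ofReal p.1 ≤ X t ω}}) =
      P {ω | ENNReal.ofReal a ≤ X t ω} := 
    uniform_ofReal_le (u := P {ω | ENNReal.ofReal a ≤ X t ω}) prob_le_one
  have hset : MeasurableSet {p : ℝ × Ω | ENNReal.ofReal p.1 ≤ X t p.2} :=
    measurableSet_le (by fun_prop) (hm.comp measurable_snd)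
  simp_rw [hslice]
  -- Both sides of the Fubini exchange compute the probability that an independent exponential
  -- variable is at most `X t`.
  calc ∫⁻ a, P {ω | ENNReal.ofReal a ≤ X t ω} ∂expMeasure lam
      = ((expMeasure lam).prod P) {p : ℝ × Ω | ENNReal.ofReal p.1 ≤ X t p.2} :=
        (Measure.prod_apply hset).symm
    _ = ∫⁻ ω, expMeasure lam {a | ENNReal.ofReal a ≤ X t ω} ∂P :=
        Measure.prod_apply_symm hset
    _ = ∫⁻ ω, (1 - expNeg (lam * X t ω)) ∂P := by simp_rw [expMeasure_ofReal_le hlam]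
    _ = 1 - expNeg (t * G lam) := by
        rw [lintegral_sub (by fun_prop) (by rw [h.lintegral_expNeg]; exact expNeg_ne_top _)
          (ae_of_all _ fun _ ↦ expNeg_le_one _), h.lintegral_expNeg]
        simp

/-- The level function transforms `Exp(lam)` into `Exp(G(lam))`. -/
theorem HasLaplaceExponent.map_inducedLevel [IsProbabilityMeasure P] (h : HasLaplaceExponent X P G)
    (hX : IsSubordinator X P) {lam : ℝ≥0} (hlam : 0 < lam) :
    ((expMeasure lam).prod (volume.restrict (Set.Ioo (0 : ℝ) 1))).map
      (fun p ↦ inducedLevel X P p.1 p.2) = extExpLaw (G lam) := by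
  have := isProbabilityMeasure_expMeasure (NNReal.coe_pos.2 hlam)
  have : IsProbabilityMeasure (volume.restrict (Set.Ioo (0 : ℝ) 1)) := ⟨by simp⟩
  have := Measure.isProbabilityMeasure_map
    (μ := (expMeasure lam).prod (volume.restrict (Set.Ioo (0 : ℝ) 1)))
    hX.measurable_inducedLevel.aemeasurable
  refine Measure.ext_of_Iio fun t ↦ ?_
  rw [Measure.map_apply hX.measurable_inducedLevel measurableSet_Iio, extExpLaw_Iio]
  rcases eq_or_ne t 0 with rfl | ht
  · simp
  obtain ⟨u, humono, hu, hut⟩ := exists_nnreal_seq_lt_tendsto (pos_iff_ne_zero.2 ht)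
  have hpre : (fun p : ℝ × ℝ ↦ inducedLevel X P p.1 p.2) ⁻¹' Set.Iio t =
      ⋃ n, {p : ℝ × ℝ | ENNReal.ofReal p.2 ≤ P {ω | ENNReal.ofReal p.1 ≤ X (u n) ω}} := by
    ext p
    simpa using hX.inducedLevel_lt_iff hu hut p.1 p.2
  rw [hpre]
  -- Continuity from below along the increasing events; the limit is then identified by continuity
  -- of `s ↦ e^{-sG(lam)}` up to `s = ∞`.
  refine tendsto_nhds_unique (tendsto_measure_iUnion_atTop fun m n hmn p hp ↦
    le_trans hp (hX.survival_mono p.1 (humono hmn))) ?_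
  simp only [Function.comp_def, h.prod_le_survival hX hlam]
  refine ENNReal.Tendsto.sub tendsto_const_nhds ?_ (Or.inl ENNReal.one_ne_top)
  simp_rw [mul_comm _ (G lam : ℝ≥0∞)]
  exact (continuous_expNeg.tendsto _).comp
    ((ENNReal.continuous_const_mul ENNReal.coe_ne_top).tendsto t |>.comp hut)

end

theorem mainTheorem2 (G : ℝ≥0 → ℝ≥0) (hG : G ∈ LevyClass) :
    (∃ (Ω : Type) (_ : MeasurableSpace Ω) (P : Measure Ω) (X : ℝ≥0 → Ω → ℝ≥0∞),
      IsProbabilityMeasure P ∧ IsSubordinator X P ∧ HasLaplaceExponent X P G) ∧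
    ∃ ℓ : ℝ → ℝ → ℝ≥0∞,
      (∀ (Ω : Type*) [MeasurableSpace Ω] (P : Measure Ω) [IsProbabilityMeasure P]
        (X : ℝ≥0 → Ω → ℝ≥0∞), IsSubordinator X P → HasLaplaceExponent X P G →
        ∀ a b : ℝ, 0 ≤ a → 0 ≤ b → b ≤ 1 → ℓ a b = inducedLevel X P a b) ∧
      (G ≠ 0 → ∀ a b : ℝ, 0 < a → 0 < b → b < 1 → ℓ a b < ∞) ∧
      (∀ a a' b b' : ℝ, 0 ≤ a → 0 ≤ b → b' ≤ 1 → a ≤ a' → b ≤ b' → ℓ a b ≤ ℓ a' b') ∧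
      (∀ (lam : ℝ≥0), 0 < lam →
        ∀ (Ω : Type*) [MeasurableSpace Ω] (P : Measure Ω) [IsProbabilityMeasure P]
          (Y U : Ω → ℝ), HasLaw Y (expMeasure lam) P →
          HasLaw U (volume.restrict (Set.Ioo 0 1)) P → IndepFun Y U P →
          HasLaw (fun ω => ℓ (Y ω) (U ω)) (extExpLaw (G lam)) P) := by
  obtain ⟨Ω₀, m₀, P₀, X₀, hP₀, hX₀, hL₀⟩ := exists_isSubordinator hG
  refine ⟨⟨Ω₀, m₀, P₀, X₀, hP₀, hX₀, hL₀⟩, inducedLevel X₀ P₀, ?_, ?_, ?_, ?_⟩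
  · intro Ω _ P _ X hX hL a b _ _ _
    exact hL₀.inducedLevel_eq hL hX₀ hX a b
  · exact fun hne a b _ _ hb ↦ hL₀.inducedLevel_lt_top hX₀ hne hb
  · exact fun a a' b b' _ _ _ ha hb ↦ inducedLevel_mono P₀ X₀ ha hb
  · intro lam hlam Ω _ P _ Y U hY hU hYU
    have hp : AEMeasurable (fun ω ↦ (Y ω, U ω)) P := hY.aemeasurable.prodMk hU.aemeasurable
    have hmap := (indepFun_iff_map_prod_eq_prod_map_map hY.aemeasurable hU.aemeasurable).1 hYU
    rw [hY.map_eq, hU.map_eq] at hmap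
    have hpair : HasLaw (fun ω ↦ (Y ω, U ω))
        ((expMeasure lam).prod (volume.restrict (Set.Ioo (0 : ℝ) 1))) P := ⟨hp, hmap⟩
    have hlevel : HasLaw (fun p : ℝ × ℝ ↦ inducedLevel X₀ P₀ p.1 p.2) (extExpLaw (G lam))
        ((expMeasure lam).prod (volume.restrict (Set.Ioo (0 : ℝ) 1))) :=
      ⟨hX₀.measurable_inducedLevel.aemeasurable, hL₀.map_inducedLevel hX₀ hlam⟩
    have key := HasLaw.comp hlevel hpair
    refine key.congr (ae_of_all _ fun ω ↦ ?_)
    rfl
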